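/- Let $n$ and $r$ be integers with $1\le r\le n-2$ and let $\alpha\in\mathbb R$ with $0\le\alpha<1$. For a connected simple graph $G$ of order $n$ (with $n$ vertices) with distance function $d_G$, let $RD(G)$ be the $n\times n$ matrix with zero diagonal and with $(u,v)$-entry $1/d_G(u,v)$ for $u\ne v$, let $RT(G)$ be the diagonal matrix with $(u,u)$-entry $\sum_{v\ne u}1/d_G(u,v)$, let $RD_\alpha(G)=\alpha\,RT(G)+(1-\alpha)\,RD(G)$, and let $\rho(RD_\alpha(G))$ be the largest eigenvalue of this real symmetric matrix. The edge connectivity of $G$ is the minimum, over all nonempty proper subsets $S$ of the vertex set, of the number of edges of $G$ between $S$ and its complement. Write $K_m$ for the complete graph on $m$ vertices, $\cup$ for disjoint union, and $\vee$ for the join (disjoint union together with all edges between the two graphs). Then, up to isomorphism, $K_r\vee(K_1\cup K_{n-r-1})$ is the unique graph with maximal $\rho(RD_\alpha(G))$ among all connected simple graphs $G$ of order $n$ with edge connectivity $r$. That is, $K_r\vee(K_1\cup K_{n-r-1})$ is itself a connected graph of order $n$ with edge connectivity $r$, and every connected simple graph $G$ of order $n$ with edge connectivity $r$ satisfies $$\rho(RD_\alpha(G))\le\rho\big(RD_\alpha(K_r\vee(K_1\cup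 K_{n-r-1}))\big),$$ with equality if and only if $G\cong K_r\vee(K_1\cup K_{n-r-1})$. -/

import Mathlib

namespace HararyAlpha

universe u v

/-- The join `G ∨ H` of two (vertex-disjoint) graphs: the disjoint union of `G` and `H` together
with all edges between a vertex of `G` and a vertex of `H`. -/
def join {V : Type u} {W : Type v} (G : SimpleGraph V) (H : SimpleGraph W) :
    SimpleGraph (V ⊕ W) :=
  (SimpleGraph.sum G H) ⊔ completeBipartiteGraph V W

/-- The vertex type of `K_r ∨ (K_1 ∪ K_{n-r-1})`. -/
abbrev ExtremalVertex (n r : ℕ) : Type := Fin r ⊕ (Fin 1 ⊕ Fin (n - r - 1))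

/-- The graph `K_r ∨ (K_1 ∪ K_{n-r-1})`. -/
def extremalGraph (n r : ℕ) : SimpleGraph (ExtremalVertex n r) :=
  join (SimpleGraph.completeGraph (Fin r))
    (SimpleGraph.sum (SimpleGraph.completeGraph (Fin 1))
      (SimpleGraph.completeGraph (Fin (n - r - 1))))

section EdgeConnectivity

variable {V : Type u}

/-- The edge cut `[S, V ∖ S]`: the edges of `G` between `S` and its complement. -/
def edgeCut (G : SimpleGraph V) (S : Set V) : Set (Sym2 V) :=
  {e | ∃ u ∈ S, ∃ v ∉ S, G.Adj u v ∧ e = s(u, v)}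

/-- The edge connectivity `κ'(G)` of a finite graph: the minimum number of edges of an edge cut
`[S, V ∖ S]`, where `S` runs over the nonempty proper subsets of the vertex set (such sets exist
when there are at least two vertices). -/
noncomputable def edgeConnectivity (G : SimpleGraph V) : ℕ :=
  sInf {k : ℕ | ∃ S : Set V, S.Nonempty ∧ S ≠ Set.univ ∧ (edgeCut G S).ncard = k}

end EdgeConnectivity

section Matrices

variable {V : Type u} [Fintype V] [DecidableEq V]

/-- The reciprocal distance (Harary) matrix `RD(G)`. -/
noncomputable def reciprocalDistanceMatrix (G : SimpleGraph V) : Matrix V V ℝ :=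
  Matrix.of fun i j => if i = j then 0 else 1 / (G.dist i j : ℝ)

/-- The reciprocal transmission of the vertex `i`: the sum of the reciprocals of the distances
from `i` to all the other vertices. -/
noncomputable def reciprocalTransmission (G : SimpleGraph V) (i : V) : ℝ :=
  ∑ j ∈ Finset.univ.erase i, 1 / (G.dist i j : ℝ)

/-- The diagonal matrix `RT(G)` of the reciprocal transmissions. -/
noncomputable def reciprocalTransmissionMatrix (G : SimpleGraph V) : Matrix V V ℝ :=
  Matrix.diagonal (reciprocalTransmission G)

/-- The matrix `RD_α(G) = α RT(G) + (1 - α) RD(G)`. -/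
noncomputable def RDAlpha (α : ℝ) (G : SimpleGraph V) : Matrix V V ℝ :=
  α • reciprocalTransmissionMatrix G + (1 - α) • reciprocalDistanceMatrix G

/-- The spectral radius `ρ(M)` of a real symmetric matrix, in the sense of its largest
eigenvalue. -/
noncomputable def largestEigenvalue (M : Matrix V V ℝ) : ℝ :=
  sSup {μ : ℝ | Module.End.HasEigenvalue (Matrix.toLin' M) μ}

end Matrices

end HararyAlpha

/-!
The Rayleigh quotient reduces the theorem to an edge-counting inequality. Twice the quadratic form
of `RD_α(G)` at `x` is `∑ q(x_i, x_j) / d(i, j)` over ordered pairs, with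
`q(a, b) = α (a² + b²) + 2 (1 - α) a b` (`pairForm`), and `q` is positive and increasing at positive
arguments. A non-adjacent pair has `1 / d ≤ 1/2`, with equality in a graph of diameter two, such as
`K_r ∨ (K_1 ∪ K_{n-r-1})`. Let `x` be the positive Perron vector of `G`
(`exists_pos_rayleigh_eq`). If some copy `K` of `K_r ∨ (K_1 ∪ K_{n-r-1})` on the vertex set of `G`
has a smaller sum of `q(x_i, x_j)` over its non-adjacent pairs than `G` has, then the form of `K`
exceeds that of `G` at `x`, so `ρ(G) < ρ(K)` (`dotProduct_RDAlpha_mulVec_lt`,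
`largestEigenvalue_lt`). The copies of the extremal graph are encoded as `attachedGraph v N`: `v` is
joined exactly to the `r` vertices of `N`, and all other vertices are pairwise adjacent.

If `G` has a vertex `v` of degree `r`, then `G` is a subgraph of `attachedGraph v N` with `N` the
neighbourhood of `v`, and the inequality is strict unless the graphs coincide. Otherwise all degrees
exceed `r`, and both sides of a minimum edge cut `[S, Sᶜ]` have at least `r + 2` vertices
(`card_of_ncard_edgeCut_lt_degree`). Let `v` minimize `x`, say `v ∈ S`, and let `N` consist of the
neighbours of `v` outside `S` together with enough further vertices of `S`. A pair `vu` with `u ∈ S`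
that is non-adjacent in the new graph is outweighed by the pairs `uw` with `w ∉ S` non-adjacent in
`G`: there are at least two of them for each `u`, and `q(x_u, x_w) ≥ q(x_u, x_v)` by the choice of
`v` (`exists_nonadjSum_attachedGraph_lt`).
-/

namespace HararyAlpha

open Finset Matrix

/-! ### The largest eigenvalue of a real symmetric matrix -/

section Spectral

variable {V : Type*} [Fintype V] [DecidableEq V]

theorem isGreatest_largestEigenvalue [Nonempty V] {M : Matrix V V ℝ} (hM : M.IsHermitian) :
    IsGreatest {μ : ℝ | Module.End.HasEigenvalue (Matrix.toLin' M) μ} (largestEigenvalue M) := by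
  have hfin : {μ : ℝ | Module.End.HasEigenvalue (Matrix.toLin' M) μ}.Finite :=
    Module.End.finite_hasEigenvalue _
  obtain ⟨i⟩ := ‹Nonempty V›
  have hne : {μ : ℝ | Module.End.HasEigenvalue (Matrix.toLin' M) μ}.Nonempty := by
    refine ⟨hM.eigenvalues i, ?_⟩
    rw [Set.mem_ofPred_eq, Module.End.hasEigenvalue_iff_mem_spectrum, Matrix.spectrum_toLin']
    exact hM.eigenvalues_mem_spectrum_real i
  exact ⟨hne.csSup_mem hfin, fun μ hμ => le_csSup hfin.bddAbove hμ⟩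

/-- The eigenvalues of `ρ • 1 - M` are the differences `ρ - μ` with `μ` an eigenvalue of `M`. -/
theorem posSemidef_largestEigenvalue_sub [Nonempty V] {M : Matrix V V ℝ} (hM : M.IsHermitian) :
    (largestEigenvalue M • (1 : Matrix V V ℝ) - M).PosSemidef := by
  have hH : (largestEigenvalue M • (1 : Matrix V V ℝ) - M).IsHermitian := by
    refine Matrix.IsHermitian.sub ?_ hM
    simp [Matrix.IsHermitian]
  rw [hH.posSemidef_iff_eigenvalues_nonneg]
  intro i
  have h := hH.eigenvalues_mem_spectrum_real i
  rw [← Matrix.spectrum_toLin', ← Module.End.hasEigenvalue_iff_mem_spectrum] at h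
  obtain ⟨y, hy⟩ := h.exists_hasEigenvector
  have hy1 := hy.apply_eq_smul
  have h2 : Module.End.HasEigenvalue (Matrix.toLin' M)
      (largestEigenvalue M - hH.eigenvalues i) := by
    refine Module.End.hasEigenvalue_of_hasEigenvector (x := y) ?_
    refine Module.End.hasEigenvector_iff.mpr ⟨Module.End.mem_eigenspace_iff.mpr ?_, hy.2⟩
    simp only [Matrix.toLin'_apply, Matrix.sub_mulVec, Matrix.smul_mulVec,
      Matrix.one_mulVec] at hy1 ⊢
    rw [sub_smul, ← hy1]
    abel
  have := (isGreatest_largestEigenvalue hM).2 h2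
  simp only [Pi.zero_apply]
  linarith

theorem dotProduct_mulVec_le_largestEigenvalue [Nonempty V] {M : Matrix V V ℝ}
    (hM : M.IsHermitian) (x : V → ℝ) :
    x ⬝ᵥ M *ᵥ x ≤ largestEigenvalue M * (x ⬝ᵥ x) := by
  have h := (posSemidef_largestEigenvalue_sub hM).dotProduct_mulVec_nonneg x
  simp only [star_trivial, Matrix.sub_mulVec, Matrix.smul_mulVec, Matrix.one_mulVec,
    dotProduct_sub, dotProduct_smul, smul_eq_mul] at h
  linarith

/-- Perron's theorem for a symmetric matrix with positive off-diagonal entries. The entrywise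
absolute value of an eigenvector for the largest eigenvalue still maximizes the Rayleigh quotient,
hence is again an eigenvector, and none of its entries can vanish. -/
theorem exists_pos_rayleigh_eq [Nonempty V] {M : Matrix V V ℝ} (hM : M.IsHermitian)
    (hpos : ∀ i j, i ≠ j → 0 < M i j) :
    ∃ x : V → ℝ, (∀ i, 0 < x i) ∧ x ⬝ᵥ M *ᵥ x = largestEigenvalue M * (x ⬝ᵥ x) := by
  obtain ⟨y, hy⟩ := (isGreatest_largestEigenvalue hM).1.exists_hasEigenvector
  have hy1 := hy.apply_eq_smul
  rw [Matrix.toLin'_apply] at hy1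
  have hle : y ⬝ᵥ M *ᵥ y ≤ |y| ⬝ᵥ M *ᵥ |y| := by
    simp only [dotProduct, mulVec, Finset.mul_sum, Pi.abs_apply]
    refine Finset.sum_le_sum fun i _ => Finset.sum_le_sum fun j _ => ?_
    by_cases hij : i = j
    · subst hij
      exact le_of_eq (by linear_combination (-(M i i)) * abs_mul_abs_self (y i))
    · have h1 : y i * y j ≤ |y i| * |y j| := by
        rw [← abs_mul]; exact le_abs_self _
      nlinarith [hpos i j hij]
  have hsq : |y| ⬝ᵥ |y| = y ⬝ᵥ y := by
    simp [dotProduct, abs_mul_abs_self]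
  have hyy : y ⬝ᵥ M *ᵥ y = largestEigenvalue M * (y ⬝ᵥ y) := by
    rw [hy1, dotProduct_smul, smul_eq_mul]
  have heq : |y| ⬝ᵥ M *ᵥ |y| = largestEigenvalue M * (|y| ⬝ᵥ |y|) :=
    le_antisymm (dotProduct_mulVec_le_largestEigenvalue hM _) (by rw [hsq, ← hyy]; exact hle)
  have hker := ((posSemidef_largestEigenvalue_sub hM).dotProduct_mulVec_zero_iff |y|).mp (by
    simp only [star_trivial, Matrix.sub_mulVec, Matrix.smul_mulVec, Matrix.one_mulVec,
      dotProduct_sub, dotProduct_smul, smul_eq_mul]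
    linarith)
  have hnn : ∀ j, 0 ≤ |y| j := fun j => abs_nonneg _
  refine ⟨|y|, fun i => lt_of_le_of_ne (hnn i) fun h0 => hy.2 ?_, heq⟩
  have hi := congrFun hker i
  simp only [Matrix.sub_mulVec, Matrix.smul_mulVec, Matrix.one_mulVec, Pi.sub_apply,
    Pi.smul_apply, Pi.zero_apply, smul_eq_mul, ← h0, mul_zero, zero_sub, neg_eq_zero] at hi
  have hterm : ∀ j ∈ (Finset.univ : Finset V), 0 ≤ M i j * |y| j := by
    intro j _
    by_cases hij : i = j
    · subst hij; simp [← h0]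
    · exact mul_nonneg (hpos i j hij).le (hnn j)
  have hall := (Finset.sum_eq_zero_iff_of_nonneg hterm).mp hi
  funext j
  by_cases hij : i = j
  · subst hij
    exact abs_eq_zero.mp h0.symm
  · have := hall j (Finset.mem_univ j)
    rcases mul_eq_zero.mp this with h | h
    · exact absurd h (hpos i j hij).ne'
    · exact abs_eq_zero.mp h

/-- It suffices to compare the quadratic forms at a single vector that attains the Rayleigh maximum
of the smaller matrix. -/
theorem largestEigenvalue_lt [Nonempty V] {M M' : Matrix V V ℝ} (hM' : M'.IsHermitian)
    {x : V → ℝ} (hx : ∀ i, 0 < x i) (hMx : x ⬝ᵥ M *ᵥ x = largestEigenvalue M * (x ⬝ᵥ x))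
    (h : x ⬝ᵥ M *ᵥ x < x ⬝ᵥ M' *ᵥ x) : largestEigenvalue M < largestEigenvalue M' := by
  have hxx : 0 < x ⬝ᵥ x :=
    Finset.sum_pos (fun i _ => mul_pos (hx i) (hx i)) Finset.univ_nonempty
  have := dotProduct_mulVec_le_largestEigenvalue hM' x
  exact lt_of_mul_lt_mul_right (by linarith) hxx.le

end Spectral

/-! ### The quadratic form of the matrix `RD_α` -/

section Form

theorem dist_iso {V W : Type*} {G : SimpleGraph V} {H : SimpleGraph W} (hG : G.Connected) (hH : H.Connected)
    (e : G ≃g H) (u v : V) : H.dist (e u) (e v) = G.dist u v := by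
  apply le_antisymm
  · obtain ⟨p, hp⟩ := hG.exists_walk_length_eq_dist u v
    rw [← hp, ← SimpleGraph.Walk.length_map e.toHom p]
    exact SimpleGraph.dist_le _
  · obtain ⟨p, hp⟩ := hH.exists_walk_length_eq_dist (e u) (e v)
    rw [← hp, ← SimpleGraph.Walk.length_map e.symm.toHom p]
    have := SimpleGraph.dist_le (p.map e.symm.toHom)
    simpa using this

/-- The contribution of a pair of vertices at distance one to the quadratic form of `RD_α`, in
terms of the values `a`, `b` of the vector at the two vertices. -/
def pairForm (α a b : ℝ) : ℝ := α * (a ^ 2 + b ^ 2) + 2 * (1 - α) * (a * b)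

open Classical in
/-- The loss incurred by the non-adjacent pairs: the sum of `pairForm` over the ordered pairs of
distinct non-adjacent vertices of `G`. -/
noncomputable def nonadjSum {V : Type*} [Fintype V] (α : ℝ) (G : SimpleGraph V) (x : V → ℝ) : ℝ :=
  ∑ i, ∑ j, if Gᶜ.Adj i j then pairForm α (x i) (x j) else 0

variable {V W : Type*} [Fintype V] [DecidableEq V] [Fintype W] [DecidableEq W]

theorem pairForm_comm (α a b : ℝ) : pairForm α a b = pairForm α b a := by
  unfold pairForm; ring

theorem pairForm_pos {α a b : ℝ} (h0 : 0 ≤ α) (h1 : α < 1) (ha : 0 < a) (hb : 0 < b) :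
    0 < pairForm α a b := by
  have : 0 < 2 * (1 - α) * (a * b) := by
    have := sub_pos.mpr h1
    positivity
  have : 0 ≤ α * (a ^ 2 + b ^ 2) := by positivity
  unfold pairForm; linarith

theorem pairForm_mono {α a b c : ℝ} (h0 : 0 ≤ α) (h1 : α < 1) (ha : 0 < a) (hb : 0 < b)
    (hbc : b ≤ c) : pairForm α a b ≤ pairForm α a c := by
  unfold pairForm
  have h3 : b ^ 2 ≤ c ^ 2 := by gcongr
  have h4 : a * b ≤ a * c := by gcongr
  have := sub_pos.mpr h1
  gcongr

theorem RDAlpha_apply_of_ne (α : ℝ) (G : SimpleGraph V) {i j : V} (h : i ≠ j) :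
    RDAlpha α G i j = (1 - α) * (1 / (G.dist i j : ℝ)) := by
  simp [RDAlpha, reciprocalTransmissionMatrix, reciprocalDistanceMatrix, h]

theorem isHermitian_RDAlpha (α : ℝ) (G : SimpleGraph V) : (RDAlpha α G).IsHermitian := by
  refine Matrix.IsHermitian.ext fun i j => ?_
  by_cases h : i = j
  · simp [h]
  · rw [RDAlpha_apply_of_ne α G h, RDAlpha_apply_of_ne α G (Ne.symm h), G.dist_comm]
    rfl

/-- The diagonal terms vanish because `G.dist i i = 0` and `1 / 0 = 0`, so the sums run over all
ordered pairs. -/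
theorem dotProduct_RDAlpha_mulVec (α : ℝ) (G : SimpleGraph V) (x : V → ℝ) :
    x ⬝ᵥ RDAlpha α G *ᵥ x =
      1 / 2 * ∑ i, ∑ j, 1 / (G.dist i j : ℝ) * pairForm α (x i) (x j) := by
  have hRT : ∀ i, reciprocalTransmission G i = ∑ j, 1 / (G.dist i j : ℝ) := fun i => by
    unfold reciprocalTransmission
    exact Finset.sum_erase _ (by simp)
  have hRD : ∀ i j, reciprocalDistanceMatrix G i j = 1 / (G.dist i j : ℝ) := fun i j => by
    by_cases h : i = j
    · simp [reciprocalDistanceMatrix, h]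
    · simp [reciprocalDistanceMatrix, h]
  have h1 : x ⬝ᵥ RDAlpha α G *ᵥ x =
      ∑ i, ∑ j, 1 / (G.dist i j : ℝ) * (α * x i ^ 2 + (1 - α) * (x i * x j)) := by
    simp only [RDAlpha, Matrix.add_mulVec, Matrix.smul_mulVec, dotProduct, Pi.add_apply,
      Pi.smul_apply, smul_eq_mul, reciprocalTransmissionMatrix, Matrix.mulVec_diagonal, hRT]
    refine Finset.sum_congr rfl fun i _ => ?_
    simp only [mulVec, dotProduct, hRD, mul_add, Finset.mul_sum, Finset.sum_mul,
      Finset.sum_add_distrib]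
    congr 1
    · exact Finset.sum_congr rfl fun j _ => by ring
    · exact Finset.sum_congr rfl fun j _ => by ring
  have h2 : ∑ i, ∑ j, 1 / (G.dist i j : ℝ) * (α * x i ^ 2 + (1 - α) * (x i * x j)) =
      ∑ i, ∑ j, 1 / (G.dist i j : ℝ) * (α * x j ^ 2 + (1 - α) * (x i * x j)) := by
    rw [Finset.sum_comm]
    refine Finset.sum_congr rfl fun i _ => Finset.sum_congr rfl fun j _ => ?_
    rw [G.dist_comm, mul_comm (x j)]
  have h3 : ∑ i, ∑ j, 1 / (G.dist i j : ℝ) * pairForm α (x i) (x j) =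
      (∑ i, ∑ j, 1 / (G.dist i j : ℝ) * (α * x i ^ 2 + (1 - α) * (x i * x j))) +
      ∑ i, ∑ j, 1 / (G.dist i j : ℝ) * (α * x j ^ 2 + (1 - α) * (x i * x j)) := by
    simp only [← Finset.sum_add_distrib, pairForm]
    refine Finset.sum_congr rfl fun i _ => Finset.sum_congr rfl fun j _ => ?_
    ring
  rw [h3, ← h2, h1]
  ring

theorem dotProduct_RDAlpha_mulVec_iso (α : ℝ) {G : SimpleGraph V} {H : SimpleGraph W}
    (hG : G.Connected) (hH : H.Connected) (e : G ≃g H) (x : W → ℝ) :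
    (x ∘ e) ⬝ᵥ RDAlpha α G *ᵥ (x ∘ e) = x ⬝ᵥ RDAlpha α H *ᵥ x := by
  rw [dotProduct_RDAlpha_mulVec, dotProduct_RDAlpha_mulVec]
  congr 1
  rw [← Equiv.sum_comp e.toEquiv]
  refine Finset.sum_congr rfl fun i _ => ?_
  rw [← Equiv.sum_comp e.toEquiv]
  refine Finset.sum_congr rfl fun j _ => ?_
  have := dist_iso hG hH e i j
  simp only [RelIso.coe_fn_toEquiv, this, Function.comp]

theorem exists_perron_vector [Nonempty V] {α : ℝ} (h1 : α < 1) {G : SimpleGraph V}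
    (hG : G.Connected) :
    ∃ x : V → ℝ, (∀ i, 0 < x i) ∧
      x ⬝ᵥ RDAlpha α G *ᵥ x = largestEigenvalue (RDAlpha α G) * (x ⬝ᵥ x) := by
  refine exists_pos_rayleigh_eq (isHermitian_RDAlpha α G) fun i j hij => ?_
  rw [RDAlpha_apply_of_ne α G hij]
  have : (0 : ℝ) < G.dist i j := by exact_mod_cast hG.pos_dist_of_ne hij
  have := sub_pos.mpr h1
  positivity

theorem largestEigenvalue_le_of_iso {α : ℝ} (h1 : α < 1) {G : SimpleGraph V} {H : SimpleGraph W}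
    (hG : G.Connected) (hH : H.Connected) (e : G ≃g H) :
    largestEigenvalue (RDAlpha α H) ≤ largestEigenvalue (RDAlpha α G) := by
  have := hG.nonempty
  have := hH.nonempty
  obtain ⟨x, hx, hxe⟩ := exists_perron_vector h1 hH
  have hxx : 0 < x ⬝ᵥ x :=
    Finset.sum_pos (fun i _ => mul_pos (hx i) (hx i)) Finset.univ_nonempty
  have h2 := dotProduct_mulVec_le_largestEigenvalue (isHermitian_RDAlpha α G) (x ∘ e)
  have h3 : (x ∘ e) ⬝ᵥ (x ∘ e) = x ⬝ᵥ x :=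
    Equiv.sum_comp e.toEquiv (fun i => x i * x i)
  rw [dotProduct_RDAlpha_mulVec_iso α hG hH e, h3, hxe] at h2
  exact le_of_mul_le_mul_right h2 hxx

theorem largestEigenvalue_eq_of_iso {α : ℝ} (h1 : α < 1) {G : SimpleGraph V} {H : SimpleGraph W}
    (hG : G.Connected) (hH : H.Connected) (e : G ≃g H) :
    largestEigenvalue (RDAlpha α G) = largestEigenvalue (RDAlpha α H) :=
  le_antisymm (largestEigenvalue_le_of_iso h1 hH hG e.symm) (largestEigenvalue_le_of_iso h1 hG hH e)

open Classical in
/-- In a graph of diameter at most two the reciprocal distances are `1` and `1/2`; in general these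
are upper bounds. -/
theorem dotProduct_RDAlpha_mulVec_lt {α : ℝ} (h0 : 0 ≤ α) (h1 : α < 1) {G H : SimpleGraph V}
    (hH : H.Connected) (hdiam : ∀ u v, H.dist u v ≤ 2) {x : V → ℝ} (hx : ∀ i, 0 < x i)
    (h : nonadjSum α H x < nonadjSum α G x) :
    x ⬝ᵥ RDAlpha α G *ᵥ x < x ⬝ᵥ RDAlpha α H *ᵥ x := by
  have hGle : ∑ i, ∑ j, 1 / (G.dist i j : ℝ) * pairForm α (x i) (x j) ≤
      (∑ i, ∑ j, if i = j then 0 else pairForm α (x i) (x j)) - 1 / 2 * nonadjSum α G x := by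
    simp only [nonadjSum, Finset.mul_sum, ← Finset.sum_sub_distrib]
    refine Finset.sum_le_sum fun i _ => Finset.sum_le_sum fun j _ => ?_
    have hq := pairForm_pos h0 h1 (hx i) (hx j)
    by_cases hij : i = j
    · simp [hij]
    by_cases ha : G.Adj i j
    · simp [hij, ha, SimpleGraph.dist_eq_one_iff_adj.mpr ha]
    · have hd : 1 / (G.dist i j : ℝ) ≤ 1 / 2 := by
        by_cases hr : G.Reachable i j
        · have : (2 : ℝ) ≤ G.dist i j := by
            exact_mod_cast hr.one_lt_dist_of_ne_of_not_adj hij ha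
          gcongr
        -- The reciprocal of the junk distance `0` is `0`.
        · rw [SimpleGraph.dist_eq_zero_of_not_reachable hr]; norm_num
      simp only [hij, ha, SimpleGraph.compl_adj, if_false, ne_eq, not_false_eq_true, and_self,
        if_true]
      nlinarith
  have hHeq : ∑ i, ∑ j, 1 / (H.dist i j : ℝ) * pairForm α (x i) (x j) =
      (∑ i, ∑ j, if i = j then 0 else pairForm α (x i) (x j)) - 1 / 2 * nonadjSum α H x := by
    simp only [nonadjSum, Finset.mul_sum, ← Finset.sum_sub_distrib]
    refine Finset.sum_congr rfl fun i _ => Finset.sum_congr rfl fun j _ => ?_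
    by_cases hij : i = j
    · simp [hij]
    by_cases ha : H.Adj i j
    · simp [hij, ha, SimpleGraph.dist_eq_one_iff_adj.mpr ha]
    · have hd : H.dist i j = 2 :=
        le_antisymm (hdiam i j) (hH.one_lt_dist_of_ne_of_not_adj hij ha)
      simp only [hd, hij, ha, SimpleGraph.compl_adj, if_false, ne_eq, not_false_eq_true, and_self,
        if_true]
      push_cast
      ring
  rw [dotProduct_RDAlpha_mulVec, dotProduct_RDAlpha_mulVec]
  linarith

end Form

/-! ### Edge cuts and degrees -/

section EdgeCuts

variable {V : Type*}

theorem edgeCut_compl (G : SimpleGraph V) (S : Set V) : edgeCut G Sᶜ = edgeCut G S := by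
  ext e
  constructor
  · rintro ⟨u, hu, w, hw, ha, rfl⟩
    exact ⟨w, not_not.mp hw, u, hu, ha.symm, Sym2.eq_swap⟩
  · rintro ⟨u, hu, w, hw, ha, rfl⟩
    exact ⟨w, hw, u, not_not.mpr hu, ha.symm, Sym2.eq_swap⟩

open Classical in
theorem ncard_edgeCut [Fintype V] (G : SimpleGraph V) (S : Set V) :
    (edgeCut G S).ncard = ∑ u with u ∈ S, #{w | w ∉ S ∧ G.Adj u w} := by
  rw [← Finset.card_sigma, ← Set.ncard_coe_finset]
  symm
  refine Set.ncard_congr (fun p _ => s(p.1, p.2)) ?_ ?_ ?_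
  · rintro ⟨u, w⟩ h
    simp only [coe_sigma, Set.mem_sigma_iff, mem_coe, mem_filter, mem_univ, true_and] at h
    exact ⟨u, h.1, w, h.2.1, h.2.2, rfl⟩
  · rintro ⟨u, w⟩ ⟨u', w'⟩ h h' he
    simp only [coe_sigma, Set.mem_sigma_iff, mem_coe, mem_filter, mem_univ, true_and] at h h'
    rcases Sym2.eq_iff.mp he with ⟨h1, h2⟩ | ⟨h1, h2⟩
    · simp only at h1 h2; subst h1 h2; rfl
    · simp only at h1 h2; subst h1 h2; exact absurd h.1 h'.2.1
  · rintro e ⟨u, hu, w, hw, ha, rfl⟩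
    exact ⟨⟨u, w⟩, by simp [hu, hw, ha], rfl⟩

theorem edgeConnectivity_le {G : SimpleGraph V} {S : Set V} (h1 : S.Nonempty)
    (h2 : S ≠ Set.univ) : edgeConnectivity G ≤ (edgeCut G S).ncard :=
  Nat.sInf_le ⟨S, h1, h2, rfl⟩

theorem exists_edgeCut_of_edgeConnectivity_pos {G : SimpleGraph V}
    (h : 0 < edgeConnectivity G) :
    ∃ S : Set V, S.Nonempty ∧ S ≠ Set.univ ∧ (edgeCut G S).ncard = edgeConnectivity G :=
  Nat.sInf_mem (Nat.nonempty_of_pos_sInf h)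

open Classical in
theorem ncard_edgeCut_singleton [Fintype V] (G : SimpleGraph V) (v : V) :
    (edgeCut G {v}).ncard = G.degree v := by
  rw [ncard_edgeCut, Finset.sum_eq_single_of_mem v (by simp) (by simp), ← SimpleGraph.card_neighborFinset_eq_degree]
  congr 1
  ext w
  simp only [Set.mem_singleton_iff, mem_filter, mem_univ, true_and,
    SimpleGraph.mem_neighborFinset, and_iff_right_iff_imp]
  exact fun h => h.ne'

open Classical in
theorem edgeConnectivity_le_degree [Fintype V] [Nontrivial V] (G : SimpleGraph V) (v : V) :
    edgeConnectivity G ≤ G.degree v := by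
  rw [← ncard_edgeCut_singleton]
  exact edgeConnectivity_le (Set.singleton_nonempty v) (Set.singleton_ne_univ v)

open Classical in
/-- If all degrees exceed the number `r` of edges leaving `S`, then `S` has more than `r + 1`
elements: a vertex of a set of `s ≤ r + 1` vertices has at least `r + 2 - s` neighbours outside,
and `s * (r + 2 - s) > r`. -/
theorem card_of_ncard_edgeCut_lt_degree [Fintype V] {G : SimpleGraph V} {S : Set V} {r : ℕ}
    (hS : S.Nonempty) (hcut : (edgeCut G S).ncard ≤ r) (hdeg : ∀ v, r < G.degree v) :
    r + 2 ≤ #{u | u ∈ S} := by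
  by_contra! hlt
  set s := #{u | u ∈ S} with hs
  have hs1 : 1 ≤ s := by
    obtain ⟨u, hu⟩ := hS
    exact Finset.card_pos.mpr ⟨u, by simpa using hu⟩
  have hout : ∀ u ∈ ({u | u ∈ S} : Finset V), r + 2 - s ≤ #{w | w ∉ S ∧ G.Adj u w} := by
    intro u hu
    have hsub : G.neighborFinset u ⊆
        ({w | w ∉ S ∧ G.Adj u w} : Finset V) ∪ ({w | w ∈ S} : Finset V).erase u := by
      intro w hw
      rw [SimpleGraph.mem_neighborFinset] at hw
      by_cases hwS : w ∈ S
      · simp [hwS, hw.ne']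
      · simp [hwS, hw]
    have h1 := (Finset.card_le_card hsub).trans (Finset.card_union_le _ _)
    rw [Finset.card_erase_of_mem hu, SimpleGraph.card_neighborFinset_eq_degree, ← hs] at h1
    have := hdeg u
    omega
  have h2 := Finset.card_nsmul_le_sum _ _ _ hout
  rw [← ncard_edgeCut, ← hs, smul_eq_mul] at h2
  obtain ⟨t, ht⟩ : ∃ t, r + 2 = s + t := ⟨r + 2 - s, by omega⟩
  rw [ht, Nat.add_sub_cancel_left] at h2
  have ht1 : 1 ≤ t := by omega
  -- `(s - 1) * (t - 1) ≥ 0` gives `s * t ≥ s + t - 1 = r + 1`.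
  nlinarith [mul_nonneg (sub_nonneg.mpr (Nat.cast_le (α := ℤ).mpr hs1))
    (sub_nonneg.mpr (Nat.cast_le (α := ℤ).mpr ht1))]

end EdgeCuts

/-! ### The extremal graph on an arbitrary vertex set -/

section Attached

variable {V W : Type*}

/-- The complete graph on `V` with all edges at `v` removed, except those to `N`. For `v ∉ N` it is
a copy of `K_r ∨ (K_1 ∪ K_{n-r-1})` on the vertex set `V`, where `n = |V|`, `r = |N|` and `v` is
the vertex of `K_1`. -/
def attachedGraph (v : V) (N : Finset V) : SimpleGraph V where
  Adj i j := i ≠ j ∧ (i = v → j ∈ N) ∧ (j = v → i ∈ N)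
  symm := ⟨fun _ _ h => ⟨h.1.symm, h.2.2, h.2.1⟩⟩
  loopless := ⟨fun _ h => h.1 rfl⟩

theorem attachedGraph_adj {v : V} {N : Finset V} {i j : V} :
    (attachedGraph v N).Adj i j ↔ i ≠ j ∧ (i = v → j ∈ N) ∧ (j = v → i ∈ N) := Iff.rfl

theorem exists_walk_attachedGraph {v : V} {N : Finset V} (hv : v ∉ N) (hN : N.Nonempty)
    (i j : V) : ∃ p : (attachedGraph v N).Walk i j, p.length ≤ 2 := by
  obtain ⟨m, hm⟩ := hN
  have hmv : m ≠ v := fun h => hv (h ▸ hm)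
  have hmadj : ∀ i, i ≠ m → (attachedGraph v N).Adj i m := fun i hi =>
    ⟨hi, fun _ => hm, fun h => absurd h hmv⟩
  by_cases hi : i = m
  · by_cases hj : j = m
    · subst hi hj; exact ⟨.nil, by simp⟩
    · subst hi; exact ⟨.cons (hmadj j hj).symm .nil, by simp⟩
  · by_cases hj : j = m
    · subst hj; exact ⟨.cons (hmadj i hi) .nil, by simp⟩
    · exact ⟨.cons (hmadj i hi) (.cons (hmadj j hj).symm .nil), by simp⟩

theorem connected_attachedGraph {v : V} {N : Finset V} (hv : v ∉ N) (hN : N.Nonempty) :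
    (attachedGraph v N).Connected :=
  (SimpleGraph.connected_iff _).mpr
    ⟨fun i j => (exists_walk_attachedGraph hv hN i j).elim fun p _ => p.reachable, ⟨v⟩⟩

theorem dist_attachedGraph_le {v : V} {N : Finset V} (hv : v ∉ N) (hN : N.Nonempty) (i j : V) :
    (attachedGraph v N).dist i j ≤ 2 :=
  (exists_walk_attachedGraph hv hN i j).elim fun p hp => (SimpleGraph.dist_le p).trans hp

/-- The edge connectivity of the attached graph is `|N|`. For a cut `[S, Sᶜ]` with `v ∈ S`, fix
`w ∉ S`; the edges joining each `u ∈ N ∩ S` to `w` and each `u ∈ N \ S` to `v` are distinct and lie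
in the cut. -/
theorem edgeConnectivity_attachedGraph [Fintype V] [Nontrivial V] {v : V} {N : Finset V}
    (hv : v ∉ N) : edgeConnectivity (attachedGraph v N) = #N := by
  classical
  have hle : ∀ S : Set V, v ∈ S → S ≠ Set.univ → #N ≤ (edgeCut (attachedGraph v N) S).ncard := by
    intro S hvS hS
    obtain ⟨w, hw⟩ := (Set.ne_univ_iff_exists_notMem S).mp hS
    have hwv : w ≠ v := fun h => hw (h ▸ hvS)
    rw [← Set.ncard_coe_finset]
    refine Set.ncard_le_ncard_of_injOn (fun u => if u ∈ S then s(u, w) else s(v, u)) ?_ ?_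
      (Set.toFinite _)
    · intro u hu
      have huN : u ∈ N := hu
      have huv : u ≠ v := fun h => hv (h ▸ hu)
      by_cases huS : u ∈ S
      · simp only [huS, if_true]
        exact ⟨u, huS, w, hw, ⟨fun h => hw (h ▸ huS), fun h => absurd h huv,
          fun h => absurd h hwv⟩, rfl⟩
      · simp only [huS, if_false]
        exact ⟨v, hvS, u, huS, ⟨huv.symm, fun _ => huN, fun h => absurd h huv⟩, rfl⟩
    · intro u hu u' hu' h
      have huv : u ≠ v := fun h => hv (h ▸ hu)
      have huv' : u' ≠ v := fun h => hv (h ▸ hu')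
      by_cases huS : u ∈ S <;> by_cases huS' : u' ∈ S <;>
        simp only [huS, huS', if_true, if_false, Sym2.eq_iff] at h <;> grind
  refine le_antisymm ?_ ?_
  · refine (edgeConnectivity_le_degree _ v).trans ?_
    rw [← SimpleGraph.card_neighborFinset_eq_degree]
    refine Finset.card_le_card fun u hu => ?_
    rw [SimpleGraph.mem_neighborFinset, attachedGraph_adj] at hu
    exact hu.2.1 rfl
  · refine le_csInf ⟨_, {v}, Set.singleton_nonempty v, Set.singleton_ne_univ v, rfl⟩ ?_
    rintro k ⟨S, hS, hSu, rfl⟩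
    by_cases hvS : v ∈ S
    · exact hle S hvS hSu
    · rw [← edgeCut_compl]
      exact hle Sᶜ hvS (by simpa [Set.compl_univ_iff] using hS.ne_empty)

theorem nonempty_iso_attachedGraph [Fintype V] [Fintype W] {v : V} {N : Finset V} {w : W}
    {M : Finset W} (hv : v ∉ N) (hw : w ∉ M) (hcard : Fintype.card V = Fintype.card W)
    (hNM : #N = #M) : Nonempty (attachedGraph v N ≃g attachedGraph w M) := by
  classical
  have e1 : {u // u ∈ N} ≃ {u // u ∈ M} := Fintype.equivOfCardEq (by simpa using hNM)
  have e2 : {u // ¬ u ∈ N} ≃ {u // ¬ u ∈ M} := Fintype.equivOfCardEq (by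
    rw [Fintype.card_subtype_compl, Fintype.card_subtype_compl]
    simp [hcard, hNM])
  let f : V ≃ W := (Equiv.sumCompl (· ∈ N)).symm.trans
    ((Equiv.sumCongr e1 e2).trans (Equiv.sumCompl (· ∈ M)))
  have hf : ∀ u, f u ∈ M ↔ u ∈ N := by
    intro u
    by_cases hu : u ∈ N
    · simp [f, hu, Equiv.sumCompl_symm_apply_of_pos]
    · simp only [f, hu, Equiv.trans_apply, Equiv.sumCompl_symm_apply_of_neg hu, iff_false]
      exact (e2 ⟨u, hu⟩).2
  -- `f` maps `N` onto `M`; swapping two elements outside `M` also sends `v` to `w`.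
  let g : V ≃ W := f.trans (Equiv.swap (f v) w)
  have hgv : g v = w := by simp [g]
  have hg : ∀ u, g u ∈ M ↔ u ∈ N := by
    intro u
    rw [← hf u]
    have hfv : f v ∉ M := by rwa [hf]
    simp only [g, Equiv.trans_apply, Equiv.swap_apply_def]
    split_ifs with h1 h2
    · rw [h1]; tauto
    · rw [h2]; tauto
    · rfl
  refine ⟨⟨g, ?_⟩⟩
  intro i j
  simp only [attachedGraph_adj, ne_eq, g.injective.eq_iff, ← hgv, hg]

/-- The vertex of `K_1` in `K_r ∨ (K_1 ∪ K_{n-r-1})`. -/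
def extremalVertex (n r : ℕ) : ExtremalVertex n r := Sum.inr (Sum.inl 0)

/-- The vertices of `K_r` in `K_r ∨ (K_1 ∪ K_{n-r-1})`. -/
def extremalCore (n r : ℕ) : Finset (ExtremalVertex n r) := univ.map Function.Embedding.inl

theorem extremalVertex_notMem_core (n r : ℕ) : extremalVertex n r ∉ extremalCore n r := by
  simp [extremalVertex, extremalCore]

theorem card_extremalCore (n r : ℕ) : #(extremalCore n r) = r := by
  simp [extremalCore]

theorem extremalGraph_eq_attachedGraph (n r : ℕ) :
    extremalGraph n r = attachedGraph (extremalVertex n r) (extremalCore n r) := by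
  ext i j
  rw [attachedGraph_adj]
  have hfin : ∀ a b : Fin 1, a = b := Subsingleton.elim
  rcases i with i | i | i <;> rcases j with j | j | j <;>
    simp [extremalGraph, join, extremalVertex, extremalCore, hfin _ 0]

theorem card_extremalVertex {n r : ℕ} (h : r + 1 ≤ n) :
    Fintype.card (ExtremalVertex n r) = n := by
  simp only [ExtremalVertex, Fintype.card_sum, Fintype.card_fin]
  omega

end Attached

/-! ### Comparison of the non-adjacent pairs -/

section Comparison

variable {V : Type*} [Fintype V]

open Classical in
theorem nonadjSum_attachedGraph (α : ℝ) {v : V} {N : Finset V} (x : V → ℝ) :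
    nonadjSum α (attachedGraph v N) x =
      2 * ∑ u, if u ≠ v ∧ u ∉ N then pairForm α (x v) (x u) else 0 := by
  have key : ∀ i j, (if (attachedGraph v N)ᶜ.Adj i j then pairForm α (x i) (x j) else 0) =
      (if i = v then (if j ≠ v ∧ j ∉ N then pairForm α (x v) (x j) else 0) else 0) +
      (if j = v then (if i ≠ v ∧ i ∉ N then pairForm α (x v) (x i) else 0) else 0) := by
    intro i j
    simp only [SimpleGraph.compl_adj, attachedGraph_adj]
    by_cases hi : i = v
    · by_cases hj : j = v
      · simp [hi, hj]
      · simp [hi, hj, Ne.symm hj]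
    · by_cases hj : j = v
      · simp [hi, hj, pairForm_comm α (x i)]
      · simp +contextual [hi, hj]
  simp only [nonadjSum, key, Finset.sum_add_distrib]
  simp only [Finset.sum_ite_eq', Finset.mem_univ, if_true, two_mul]
  congr 1
  rw [Finset.sum_comm]
  simp

/-- The non-adjacent pairs separated by `S`, each counted in both orders, are among the ordered
non-adjacent pairs. -/
theorem two_mul_sum_cross_le_nonadjSum {α : ℝ} (h0 : 0 ≤ α) (h1 : α < 1) (G : SimpleGraph V)
    {x : V → ℝ} (hx : ∀ i, 0 < x i) (S : Finset V) [DecidableEq V] [DecidableRel G.Adj] :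
    2 * ∑ u ∈ S, ∑ w with w ∉ S ∧ ¬ G.Adj u w, pairForm α (x u) (x w) ≤ nonadjSum α G x := by
  have h2 : 2 * ∑ u ∈ S, ∑ w with w ∉ S ∧ ¬ G.Adj u w, pairForm α (x u) (x w) =
      ∑ i, ∑ j, ((if i ∈ S ∧ j ∉ S ∧ ¬ G.Adj i j then pairForm α (x i) (x j) else 0) +
        (if j ∈ S ∧ i ∉ S ∧ ¬ G.Adj j i then pairForm α (x j) (x i) else 0)) := by
    have : ∑ u ∈ S, ∑ w with w ∉ S ∧ ¬ G.Adj u w, pairForm α (x u) (x w) =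
        ∑ i, ∑ j, if i ∈ S ∧ j ∉ S ∧ ¬ G.Adj i j then pairForm α (x i) (x j) else 0 := by
      simp only [Finset.sum_filter, ite_and (_ ∈ S), Finset.sum_ite_irrel, Finset.sum_const_zero]
      simp
    simp only [Finset.sum_add_distrib]
    rw [Finset.sum_comm (f := fun i j => if j ∈ S ∧ i ∉ S ∧ ¬ G.Adj j i then _ else _), ← this,
      two_mul]
  rw [h2, nonadjSum]
  refine Finset.sum_le_sum fun i _ => Finset.sum_le_sum fun j _ => ?_
  have hq := pairForm_pos h0 h1 (hx i) (hx j)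
  simp only [pairForm_comm α (x j), G.adj_comm j, SimpleGraph.compl_adj]
  by_cases hi : i ∈ S <;> by_cases hj : j ∈ S <;> by_cases ha : G.Adj i j
  all_goals try (simp [hi, hj, ha]; done)
  · simp only [hi, hj, ha]; simp; split_ifs <;> simp [hq.le]
  · have : i ≠ j := fun h => hj (h ▸ hi)
    simp [hi, hj, ha, this]
  · have : i ≠ j := fun h => hi (h ▸ hj)
    simp [hi, hj, ha, this]
  · simp only [hi, hj, ha]; simp; split_ifs <;> simp [hq.le]

open Classical in
theorem nonadjSum_lt_of_lt {α : ℝ} (h0 : 0 ≤ α) (h1 : α < 1) {G H : SimpleGraph V} (h : G < H)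
    {x : V → ℝ} (hx : ∀ i, 0 < x i) : nonadjSum α H x < nonadjSum α G x := by
  have hle : ∀ i j, (if Hᶜ.Adj i j then pairForm α (x i) (x j) else 0) ≤
      if Gᶜ.Adj i j then pairForm α (x i) (x j) else 0 := by
    intro i j
    have hq := (pairForm_pos h0 h1 (hx i) (hx j)).le
    split_ifs with h2 h3 h3
    · exact le_rfl
    · exact absurd (compl_le_compl h.le h2) h3
    · exact hq
    · exact le_rfl
  obtain ⟨i, j, hH, hG⟩ : ∃ i j, H.Adj i j ∧ ¬ G.Adj i j := by
    by_contra! hc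
    exact h.not_ge fun i j => hc i j
  refine Finset.sum_lt_sum (fun i _ => Finset.sum_le_sum fun j _ => hle i j)
    ⟨i, Finset.mem_univ i, Finset.sum_lt_sum (fun j _ => hle i j) ⟨j, Finset.mem_univ j, ?_⟩⟩
  simpa [SimpleGraph.compl_adj, hH, hG, hH.ne] using pairForm_pos h0 h1 (hx i) (hx j)

open Classical in
/-- Moving the whole edge cut to the vertex `v`. The vertex `v` minimizes `x`, lies in `S`, and
keeps `r` neighbours, among them all its neighbours outside `S`. Every edge `vu` lost with `u ∈ S`
is paid for by the new edges from `u` to the other side, of which there are at least two. -/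
theorem exists_nonadjSum_attachedGraph_lt {α : ℝ} (h0 : 0 ≤ α) (h1 : α < 1) {G : SimpleGraph V}
    {x : V → ℝ} (hx : ∀ i, 0 < x i) {r : ℕ} {S : Set V} {v : V} (hvS : v ∈ S)
    (hSu : S ≠ Set.univ) (hcut : (edgeCut G S).ncard = r) (hdeg : ∀ v, r < G.degree v)
    (hmin : ∀ u, x v ≤ x u) :
    ∃ N : Finset V, v ∉ N ∧ #N = r ∧ nonadjSum α (attachedGraph v N) x < nonadjSum α G x := by
  set A : Finset V := {u | u ∈ S} with hA
  have hmemA : ∀ u, u ∈ A ↔ u ∈ S := fun u => by simp [hA]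
  have hvA : v ∈ A := (hmemA v).mpr hvS
  have hAcard : r + 2 ≤ #A := card_of_ncard_edgeCut_lt_degree ⟨v, hvS⟩ hcut.le hdeg
  have hBcard : r + 2 ≤ #{u | u ∉ S} := by
    have h := card_of_ncard_edgeCut_lt_degree (S := Sᶜ) (Set.nonempty_compl.mpr hSu)
      (by rw [edgeCut_compl]; exact hcut.le) hdeg
    simpa only [Set.mem_compl_iff] using h
  have hcross : ∀ u ∈ A, #{w | w ∉ S ∧ G.Adj u w} ≤ r := by
    intro u hu
    rw [← hcut, ncard_edgeCut]
    exact Finset.single_le_sum (f := fun u => #{w | w ∉ S ∧ G.Adj u w})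
      (fun _ _ => Nat.zero_le _) hu
  set T : Finset V := {w | w ∉ S ∧ G.Adj v w} with hT
  have hsub : G.neighborFinset v ⊆ T ∪ A.erase v := by
    intro w hw
    rw [SimpleGraph.mem_neighborFinset] at hw
    by_cases hwS : w ∈ S
    · simp [hA, hwS, hw.ne']
    · simp [hT, hwS, hw]
  have hr : r ≤ #(T ∪ A.erase v) := by
    have := Finset.card_le_card hsub
    rw [SimpleGraph.card_neighborFinset_eq_degree] at this
    exact (hdeg v).le.trans this
  obtain ⟨N, hTN, hNs, hNr⟩ :=
    Finset.exists_subsuperset_card_eq (Finset.subset_union_left (s₂ := A.erase v))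
      (hcross v hvA) hr
  have hvN : v ∉ N := fun h => by
    have := hNs h
    simp [hvS] at this
  refine ⟨N, hvN, hNr, ?_⟩
  refine lt_of_lt_of_le ?_ (two_mul_sum_cross_le_nonadjSum h0 h1 G hx A)
  rw [nonadjSum_attachedGraph]
  refine mul_lt_mul_of_pos_left ?_ two_pos
  rw [← Finset.sum_filter, ← Finset.add_sum_erase _ _ hvA]
  have hsplit : ({u | u ≠ v ∧ u ∉ N} : Finset V) ⊆
      ({w | w ∉ A ∧ ¬ G.Adj v w} : Finset V) ∪ A.erase v := by
    intro u hu
    simp only [mem_filter, mem_univ, true_and] at hu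
    by_cases huA : u ∈ A
    · simp [huA, hu.1]
    · have : ¬ G.Adj v u := fun h => hu.2 (hTN (by
        rw [hmemA] at huA
        simp [huA, h]))
      simp [huA, this]
  have hqpos : ∀ u w, 0 < pairForm α (x u) (x w) := fun u w => pairForm_pos h0 h1 (hx u) (hx w)
  refine (Finset.sum_le_sum_of_subset_of_nonneg hsplit fun u _ _ => (hqpos v u).le).trans_lt ?_
  rw [Finset.sum_union (by
    rw [Finset.disjoint_left]
    intro u hu hu'
    simp only [mem_filter, mem_univ, true_and] at hu
    exact hu.1 (Finset.mem_of_mem_erase hu'))]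
  refine add_lt_add_of_le_of_lt le_rfl (Finset.sum_lt_sum_of_nonempty ?_ ?_)
  · rw [← Finset.card_pos, Finset.card_erase_of_mem hvA]
    omega
  · intro u hu
    have huA := Finset.mem_of_mem_erase hu
    have hcard : 1 < #{w | w ∉ A ∧ ¬ G.Adj u w} := by
      have h3 := hcross u huA
      have h4 : #{u | u ∉ S} ≤ #{w | w ∉ S ∧ G.Adj u w} + #{w | w ∉ A ∧ ¬ G.Adj u w} := by
        refine (Finset.card_le_card fun w hw => ?_).trans (Finset.card_union_le _ _)
        simp only [mem_union, mem_filter, mem_univ, true_and, hmemA] at hw ⊢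
        tauto
      omega
    obtain ⟨w, hw, w', hw', hne⟩ := Finset.one_lt_card.mp hcard
    calc pairForm α (x v) (x u) = pairForm α (x u) (x v) := pairForm_comm _ _ _
      _ ≤ pairForm α (x u) (x w) := pairForm_mono h0 h1 (hx u) (hx v) (hmin w)
      _ < pairForm α (x u) (x w) + pairForm α (x u) (x w') := lt_add_of_pos_right _ (hqpos u w')
      _ = ∑ y ∈ {w, w'}, pairForm α (x u) (x y) := by
        rw [Finset.sum_pair hne]
      _ ≤ _ := Finset.sum_le_sum_of_subset_of_nonneg (by
          intro y hy
          rcases Finset.mem_insert.mp hy with rfl | hy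
          · exact hw
          · rwa [Finset.mem_singleton.mp hy]) fun y _ _ => (hqpos u y).le

open Classical in
/-- Some copy of the extremal graph on the vertex set of `G` loses strictly less on its non-adjacent
pairs than `G`, unless `G` is itself such a copy. The two cases are whether or not `G` has a vertex
whose degree equals the edge connectivity. -/
theorem exists_eq_or_nonadjSum_attachedGraph_lt [Nontrivial V] {α : ℝ} (h0 : 0 ≤ α) (h1 : α < 1)
    {G : SimpleGraph V} {x : V → ℝ} (hx : ∀ i, 0 < x i) (hpos : 0 < edgeConnectivity G) :
    ∃ (v : V) (N : Finset V), v ∉ N ∧ #N = edgeConnectivity G ∧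
      (G = attachedGraph v N ∨ nonadjSum α (attachedGraph v N) x < nonadjSum α G x) := by
  by_cases hd : ∀ v, edgeConnectivity G < G.degree v
  · obtain ⟨S, hS, hSu, hcut⟩ := exists_edgeCut_of_edgeConnectivity_pos hpos
    obtain ⟨v, hmin⟩ := Finite.exists_min x
    by_cases hvS : v ∈ S
    · obtain ⟨N, h2, h3, h4⟩ := exists_nonadjSum_attachedGraph_lt h0 h1 hx hvS hSu hcut hd hmin
      exact ⟨v, N, h2, h3, .inr h4⟩
    · obtain ⟨N, h2, h3, h4⟩ := exists_nonadjSum_attachedGraph_lt h0 h1 hx (S := Sᶜ) hvS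
        (by simpa [Set.compl_univ_iff] using hS.ne_empty) (by rwa [edgeCut_compl]) hd hmin
      exact ⟨v, N, h2, h3, .inr h4⟩
  · push Not at hd
    obtain ⟨v, hv⟩ := hd
    refine ⟨v, G.neighborFinset v, by simp, ?_, ?_⟩
    · rw [SimpleGraph.card_neighborFinset_eq_degree]
      exact le_antisymm hv (edgeConnectivity_le_degree G v)
    · have hle : G ≤ attachedGraph v (G.neighborFinset v) := by
        intro i j h
        refine ⟨h.ne, ?_, ?_⟩
        · rintro rfl; simpa using h
        · rintro rfl; simpa using h.symm
      exact hle.eq_or_lt.imp id fun h => nonadjSum_lt_of_lt h0 h1 h hx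

end Comparison

end HararyAlpha

/-! ### The extremal graph maximizes the spectral radius -/

open HararyAlpha in
theorem theorem4p3 (n r : ℕ) (hr : 1 ≤ r) (hrn : r + 2 ≤ n)
    (α : ℝ) (hα0 : 0 ≤ α) (hα1 : α < 1) :
    (Fintype.card (HararyAlpha.ExtremalVertex n r) = n ∧
      (HararyAlpha.extremalGraph n r).Connected ∧
      HararyAlpha.edgeConnectivity (HararyAlpha.extremalGraph n r) = r) ∧
    ∀ (V : Type*) [Fintype V] [DecidableEq V] (G : SimpleGraph V),
      Fintype.card V = n → G.Connected → HararyAlpha.edgeConnectivity G = r →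
        HararyAlpha.largestEigenvalue (HararyAlpha.RDAlpha α G) ≤
            HararyAlpha.largestEigenvalue
              (HararyAlpha.RDAlpha α (HararyAlpha.extremalGraph n r)) ∧
        (HararyAlpha.largestEigenvalue (HararyAlpha.RDAlpha α G) =
            HararyAlpha.largestEigenvalue
              (HararyAlpha.RDAlpha α (HararyAlpha.extremalGraph n r)) ↔
          Nonempty (G ≃g HararyAlpha.extremalGraph n r)) := by
  have hcardE := card_extremalVertex (n := n) (r := r) (by omega)
  have hntE : Nontrivial (ExtremalVertex n r) := Fintype.one_lt_card_iff_nontrivial.mp (by omega)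
  have hvE := extremalVertex_notMem_core n r
  have hNE := card_extremalCore n r
  have hconnE : (extremalGraph n r).Connected := by
    rw [extremalGraph_eq_attachedGraph]
    exact connected_attachedGraph hvE (Finset.card_pos.mp (by omega))
  refine ⟨⟨hcardE, hconnE, ?_⟩, ?_⟩
  · rw [extremalGraph_eq_attachedGraph, edgeConnectivity_attachedGraph hvE, hNE]
  intro V _ _ G hV hG hκ
  have hnt : Nontrivial V := Fintype.one_lt_card_iff_nontrivial.mp (by omega)
  have hiso : Nonempty (G ≃g extremalGraph n r) → largestEigenvalue (RDAlpha α G) =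
      largestEigenvalue (RDAlpha α (extremalGraph n r)) :=
    fun ⟨e⟩ => largestEigenvalue_eq_of_iso hα1 hG hconnE e
  obtain ⟨x, hx, hxe⟩ := exists_perron_vector hα1 hG
  obtain ⟨v, N, hvN, hN, h⟩ :=
    exists_eq_or_nonadjSum_attachedGraph_lt hα0 hα1 hx (G := G) (by omega)
  have hNne : N.Nonempty := Finset.card_pos.mp (by omega)
  have hKE : Nonempty (attachedGraph v N ≃g extremalGraph n r) := by
    rw [extremalGraph_eq_attachedGraph]
    exact nonempty_iso_attachedGraph hvN hvE (by omega) (by omega)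
  rcases h with h | h
  · rw [← h] at hKE
    exact ⟨(hiso hKE).le, fun _ => hKE, hiso⟩
  · have hconnK := connected_attachedGraph hvN hNne
    have hlt := largestEigenvalue_lt (isHermitian_RDAlpha α (attachedGraph v N)) hx hxe
      (dotProduct_RDAlpha_mulVec_lt hα0 hα1 hconnK (dist_attachedGraph_le hvN hNne) hx h)
    rw [largestEigenvalue_eq_of_iso hα1 hconnK hconnE hKE.some] at hlt
    exact ⟨hlt.le, fun he => absurd he hlt.ne, hiso⟩
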